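/- \textbf{Solomon's theorem.} Let $W$ be a finite Coxeter group with set of simple reflections $S$ and length function $\ell\colon W\to\mathbb{N}\cup\{0\}$. For $J\subseteq S$, let $W_J=\langle J\rangle$ be the standard parabolic subgroup of $W$ generated by $J$, and let $\pi_J$ denote the permutation character of the action of $W$ on the cosets of $W_J$, defined by $$\pi_J(w)=\bigl|\mathrm{Fix}_{W/W_J}(w)\bigr| \qquad (w\in W),$$ the number of cosets of $W_J$ fixed by $w$. Let $\epsilon$ be the sign character of $W$, defined by $\epsilon(w)=(-1)^{\ell(w)}$ for $w\in W$. Then $$\sum_{J\subseteq S}(-1)^{|J|}\,\pi_J=\epsilon .$$ -/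

import Mathlib

open scoped BigOperators

noncomputable section

namespace CoxeterSystem

variable {B W : Type*} [Group W] {M : CoxeterMatrix B} (cs : CoxeterSystem M W)

/-- The set `S` of simple reflections of a Coxeter system `(W, S)` with `W` finite, as a finite
subset of `W`. -/
def simpleReflections [Finite W] : Finset W :=
  (Set.toFinite (Set.range cs.simple)).toFinset

/-- The sign character `ε : W → {1, -1}`, given by `ε(w) = (-1) ^ ℓ(w)`. -/
def signCharacter : W →* ℤ where
  toFun w := (-1) ^ cs.length w
  map_one' := by simp
  map_mul' v w := by
    rw [← pow_add, neg_one_pow_eq_pow_mod_two, cs.length_mul_mod_two,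
      ← neg_one_pow_eq_pow_mod_two]

end CoxeterSystem

/-- For a subset `J` of a group `W`, the character of the permutation action of `W` by left
multiplication on the cosets of the subgroup `W_J = ⟨J⟩`: its value at `w` is the number of
cosets in `W / W_J` fixed by `w`. -/
def cosetPermutationCharacter {W : Type*} [Group W] (J : Set W) : W → ℤ := fun w =>
  (Nat.card (MulAction.fixedBy (W ⧸ Subgroup.closure J) w) : ℤ)

end

/-! Write `χ` for the alternating sum and ⟨f, g⟩ = |W|⁻¹ ∑ f(w) g(w). It suffices that ⟨χ, χ⟩ = ⟨χ,
ε⟩ = ⟨ε, ε⟩ = 1, for then ∑ (χ - ε)² = 0. For J ≠ ∅, ⟨π_J, ε⟩ = 0 because W_J contains an element of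
sign -1; π_∅ is the regular character and contributes 1. By Burnside, ⟨π_J, π_K⟩ counts the (W_J,
W_K) double cosets, and each contains exactly one element with no left descent in J and no right
descent in K. Inclusion-exclusion over J and K leaves in ⟨χ, χ⟩ only the elements having every
simple reflection as a left and a right descent: the longest element alone. Both uniqueness
statements rest on the exchange condition, obtained from an action of W on W × ZMod 2 that counts
inversions mod 2. -/

namespace CoxeterSystem

open List

variable {B W : Type*} [Group W] {M : CoxeterMatrix B} (cs : CoxeterSystem M W)

/-! ### The exchange condition -/

open Classical in
/-- The map `(t, e) ↦ (s t s⁻¹, e + [t = s])` attached to a simple reflection `s = s i`. -/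
noncomputable def parityStep (i : B) : Function.End (W × ZMod 2) := fun p =>
  (cs.simple i * p.1 * cs.simple i, p.2 + if p.1 = cs.simple i then 1 else 0)

open Classical in
-- The elements (s_j s_i)^k s_j, k < 2n, are the right inversion sequence of the word (i j)^n, read
-- from its end.
theorem parityStep_mul_pow_apply (i j : B) (n : ℕ) (t : W) (e : ZMod 2) :
    ((cs.parityStep i * cs.parityStep j) ^ n : Function.End (W × ZMod 2)) (t, e) =
      ((cs.simple i * cs.simple j) ^ n * t * (cs.simple j * cs.simple i) ^ n,
        e + ∑ k ∈ Finset.range (2 * n),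
          if t = (cs.simple j * cs.simple i) ^ k * cs.simple j then 1 else 0) := by
  induction n with
  | zero =>
    rw [pow_zero]
    exact show (t, e) = _ by simp
  | succ n ih =>
    have hmul : ∀ (f g : Function.End (W × ZMod 2)) p, (f * g) p = f (g p) := fun _ _ _ => rfl
    set a := cs.simple i with ha
    set b := cs.simple j with hb
    have hinv : ((a * b) ^ n)⁻¹ = (b * a) ^ n := by
      rw [← inv_pow, mul_inv_rev, ha, hb, cs.inv_simple, cs.inv_simple]
    have hcomm : b * (a * b) ^ n = (b * a) ^ n * b := by
      have : SemiconjBy b (a * b) (b * a) := by simp [SemiconjBy, mul_assoc]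
      exact (this.pow_right n).eq
    have h1 : ((a * b) ^ n * t * (b * a) ^ n = b) ↔ t = (b * a) ^ (2 * n) * b := by
      rw [← hinv, mul_inv_eq_iff_eq_mul, ← eq_inv_mul_iff_mul_eq, hinv, hcomm, two_mul, pow_add,
        mul_assoc]
    have h2 : (b * ((a * b) ^ n * t * (b * a) ^ n) * b = a) ↔
        t = (b * a) ^ (2 * n + 1) * b := by
      have hbinv : b⁻¹ = b := cs.inv_simple j
      rw [← eq_mul_inv_iff_mul_eq, ← eq_inv_mul_iff_mul_eq, ← hinv, mul_inv_eq_iff_eq_mul,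
        ← eq_inv_mul_iff_mul_eq, hinv, hbinv]
      have : (b * a) ^ n * (b * (a * b) * (a * b) ^ n) = (b * a) ^ (2 * n + 1) * b := by
        calc _ = (b * a) ^ n * ((b * a) * (b * (a * b) ^ n)) := by simp only [mul_assoc]
          _ = (b * a) ^ n * ((b * a) ^ 1 * ((b * a) ^ n * b)) := by rw [hcomm, pow_one]
          _ = _ := by rw [← mul_assoc, ← mul_assoc, ← pow_add, ← pow_add]; congr 2; omega
      rw [this]
    rw [pow_succ', hmul, ih, hmul]
    simp only [parityStep, ← ha, ← hb]
    rw [if_congr h1 rfl rfl, if_congr h2 rfl rfl]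
    refine Prod.ext ?_ ?_
    · simp only [pow_succ' (a * b), pow_succ (b * a), mul_assoc]
    · rw [mul_add_one, Finset.sum_range_succ, Finset.sum_range_succ]
      simp only [add_assoc]

theorem isLiftable_parityStep : M.IsLiftable cs.parityStep := by
  classical
  intro i j
  funext ⟨t, e⟩
  rw [parityStep_mul_pow_apply]
  have hsum : ∀ k, (cs.simple j * cs.simple i) ^ (M i j + k) = (cs.simple j * cs.simple i) ^ k := by
    intro k
    rw [pow_add, cs.simple_mul_simple_pow', one_mul]
  -- The summand has period `M i j` in k, so the two halves of the sum cancel mod 2.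
  rw [two_mul, Finset.sum_range_add]
  simp only [hsum, CharTwo.add_self_eq_zero, add_zero, cs.simple_mul_simple_pow,
    cs.simple_mul_simple_pow', one_mul, mul_one]
  rfl

open Classical in
theorem lift_parityStep_wordProd (ω : List B) (t : W) :
    cs.lift ⟨cs.parityStep, cs.isLiftable_parityStep⟩ (cs.wordProd ω) (t, 0) =
      (cs.wordProd ω * t * (cs.wordProd ω)⁻¹, ((cs.rightInvSeq ω).count t : ZMod 2)) := by
  have hmul : ∀ (f g : Function.End (W × ZMod 2)) p, (f * g) p = f (g p) := fun _ _ _ => rfl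
  induction ω with
  | nil =>
    rw [wordProd_nil, map_one]
    exact show (t, 0) = _ by simp
  | cons i ω ih =>
    rw [wordProd_cons, map_mul, hmul, ih, lift_apply_simple]
    simp only [parityStep, rightInvSeq, mul_inv_rev, cs.inv_simple, count_cons, mul_assoc]
    have : (cs.wordProd ω * (t * (cs.wordProd ω)⁻¹) = cs.simple i) ↔
        ((cs.wordProd ω)⁻¹ * (cs.simple i * cs.wordProd ω) = t) := by
      rw [← mul_assoc, mul_inv_eq_iff_eq_mul, inv_mul_eq_iff_eq_mul, eq_comm]
    simp [this]

open Classical in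
/-- The parity of the number of occurrences of `t` in the right inversion sequence of a word only
depends on the product of the word. -/
theorem count_rightInvSeq_eq_of_wordProd_eq {ω ω' : List B} (h : cs.wordProd ω = cs.wordProd ω')
    (t : W) :
    ((cs.rightInvSeq ω).count t : ZMod 2) = ((cs.rightInvSeq ω').count t : ZMod 2) := by
  have h₁ := cs.lift_parityStep_wordProd ω t
  rw [h, lift_parityStep_wordProd] at h₁
  exact (congrArg Prod.snd h₁).symm

/-- If s = s_i were absent, it would occur exactly once in the sequence of the word followed by i.
By parity it would occur for a reduced word of ws, making s a right descent of ws rather than of w.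
-/
theorem simple_mem_rightInvSeq {ω : List B} {i : B}
    (h : cs.IsRightDescent (cs.wordProd ω) i) : cs.simple i ∈ cs.rightInvSeq ω := by
  classical
  by_contra hmem
  obtain ⟨ω', hred, hω'⟩ := cs.exists_isReduced (cs.wordProd ω * cs.simple i)
  have h₁ := cs.count_rightInvSeq_eq_of_wordProd_eq (ω := ω.concat i) (ω' := ω')
    (by rw [wordProd_concat, hω']) (cs.simple i)
  have hcount : (cs.rightInvSeq (ω.concat i)).count (cs.simple i) = 1 := by
    rw [rightInvSeq_concat, concat_eq_append, count_append]
    have : cs.simple i ∉ (cs.rightInvSeq ω).map (MulAut.conj (cs.simple i)) := by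
      intro hm
      obtain ⟨u, hu, hu'⟩ := List.mem_map.1 hm
      have : u = cs.simple i := by
        apply (MulAut.conj (cs.simple i)).injective
        rw [hu']
        simp
      exact hmem (this ▸ hu)
    rw [count_eq_zero.2 this]
    simp
  have hmem' : cs.simple i ∈ cs.rightInvSeq ω' := by
    by_contra hn
    rw [hcount, count_eq_zero.2 hn] at h₁
    exact absurd h₁ (by decide)
  have h₂ := (cs.isRightInversion_of_mem_rightInvSeq hred hmem').2
  rw [← hω', simple_mul_simple_cancel_right] at h₂
  exact absurd h (by unfold IsRightDescent; omega)

/-- The exchange condition. -/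
theorem exists_eraseIdx_of_isRightDescent {ω : List B} {i : B}
    (h : cs.IsRightDescent (cs.wordProd ω) i) :
    ∃ j < ω.length, cs.wordProd ω * cs.simple i = cs.wordProd (ω.eraseIdx j) := by
  obtain ⟨j, hj, hj'⟩ := List.getElem_of_mem (cs.simple_mem_rightInvSeq h)
  refine ⟨j, by simpa using hj, ?_⟩
  rw [← wordProd_mul_getD_rightInvSeq, getD_eq_getElem _ _ hj, hj']

/-- Every word has a reduced subword with the same product. -/
theorem exists_isReduced_sublist (ω : List B) :
    ∃ ω', ω'.Sublist ω ∧ cs.IsReduced ω' ∧ cs.wordProd ω' = cs.wordProd ω := by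
  induction ω using List.reverseRecOn with
  | nil => exact ⟨[], Sublist.refl _, by simp [IsReduced], rfl⟩
  | append_singleton ω i ih =>
    obtain ⟨ω', hsub, hred, hprod⟩ := ih
    have key : cs.wordProd (ω ++ [i]) = cs.wordProd ω' * cs.simple i := by
      simp [wordProd_append, hprod]
    by_cases hd : cs.IsRightDescent (cs.wordProd ω') i
    · obtain ⟨j, hj, hj'⟩ := cs.exists_eraseIdx_of_isRightDescent hd
      refine ⟨ω'.eraseIdx j, ((eraseIdx_sublist _ _).trans hsub).trans (sublist_append_left _ _),
        ?_, by rw [key, hj']⟩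
      have h₁ := cs.isRightDescent_iff.1 hd
      rw [hj', hred.eq] at h₁
      have h₂ := length_eraseIdx_add_one hj
      unfold IsReduced
      omega
    · refine ⟨ω' ++ [i], hsub.append_right _, ?_, by rw [key]; simp [wordProd_append]⟩
      have h₁ := cs.not_isRightDescent_iff.1 hd
      rw [hred.eq] at h₁
      unfold IsReduced
      simp [wordProd_append, h₁]

/-! ### Minimal double coset representatives -/

theorem exists_wordProd_eq_of_mem_closure {J : Set W} (hJ : J ⊆ Set.range cs.simple) {u : W}
    (hu : u ∈ Subgroup.closure J) :
    ∃ ω : List B, (∀ i ∈ ω, cs.simple i ∈ J) ∧ cs.wordProd ω = u := by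
  induction hu using Subgroup.closure_induction with
  | mem x hx =>
    obtain ⟨i, rfl⟩ := hJ hx
    exact ⟨[i], by simpa using hx, by simp⟩
  | one => exact ⟨[], by simp, by simp⟩
  | mul x y _ _ hx hy =>
    obtain ⟨α, hα, rfl⟩ := hx
    obtain ⟨β, hβ, rfl⟩ := hy
    refine ⟨α ++ β, fun i hi => ?_, cs.wordProd_append α β⟩
    rcases List.mem_append.1 hi with hi | hi
    exacts [hα i hi, hβ i hi]
  | inv x _ hx =>
    obtain ⟨α, hα, rfl⟩ := hx
    exact ⟨α.reverse, fun i hi => hα i (List.mem_reverse.1 hi), cs.wordProd_reverse α⟩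

theorem wordProd_mem_closure {J : Set W} {ω : List B} (h : ∀ i ∈ ω, cs.simple i ∈ J) :
    cs.wordProd ω ∈ Subgroup.closure J := by
  refine Subgroup.list_prod_mem _ fun x hx => ?_
  obtain ⟨i, hi, rfl⟩ := List.mem_map.1 hx
  exact Subgroup.subset_closure (h i hi)

/-- `w` has no left descent in `J` and no right descent in `K`. -/
def IsDoubleCosetMin (J K : Set W) (w : W) : Prop :=
  (∀ s ∈ J, cs.length w < cs.length (s * w)) ∧ ∀ s ∈ K, cs.length w < cs.length (w * s)

/-- Take a reduced subword α'δ'β' of αδβ with product x. Minimality of d forces δ' = δ, and a first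
letter of α' or a last letter of β' would be a forbidden descent of x. -/
theorem eq_of_isDoubleCosetMin_of_forall_le {J K : Set W} (hJ : J ⊆ Set.range cs.simple)
    (hK : K ⊆ Set.range cs.simple) {x d u v : W} (hx : cs.IsDoubleCosetMin J K x)
    (hu : u ∈ Subgroup.closure J) (hv : v ∈ Subgroup.closure K) (hxd : x = u * d * v)
    (hd : ∀ a ∈ Subgroup.closure J, ∀ b ∈ Subgroup.closure K,
      cs.length d ≤ cs.length (a * d * b)) : x = d := by
  obtain ⟨α, hα, rfl⟩ := cs.exists_wordProd_eq_of_mem_closure hJ hu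
  obtain ⟨β, hβ, rfl⟩ := cs.exists_wordProd_eq_of_mem_closure hK hv
  obtain ⟨δ, hδ, rfl⟩ := cs.exists_isReduced d
  obtain ⟨ω, hsub, hred, hprod⟩ := cs.exists_isReduced_sublist (α ++ δ ++ β)
  obtain ⟨ω₁, β', rfl, hsub₁, hβ'⟩ := sublist_append_iff.1 hsub
  obtain ⟨α', δ', rfl, hα', hδ'⟩ := sublist_append_iff.1 hsub₁
  have hα'J : ∀ i ∈ α', cs.simple i ∈ J := fun i hi => hα i (hα'.subset hi)
  have hβ'K : ∀ i ∈ β', cs.simple i ∈ K := fun i hi => hβ i (hβ'.subset hi)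
  have hδδ' : δ' = δ := by
    refine hδ'.eq_of_length_le ?_
    have h₁ := hd ((cs.wordProd α')⁻¹ * cs.wordProd α)
      (mul_mem (inv_mem (cs.wordProd_mem_closure hα'J)) hu)
      (cs.wordProd β * (cs.wordProd β')⁻¹)
      (mul_mem hv (inv_mem (cs.wordProd_mem_closure hβ'K)))
    have h₂ : (cs.wordProd α')⁻¹ * cs.wordProd α * cs.wordProd δ *
        (cs.wordProd β * (cs.wordProd β')⁻¹) = cs.wordProd δ' := by
      simp only [wordProd_append] at hprod
      rw [← mul_assoc, mul_inv_eq_iff_eq_mul]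
      simp only [mul_assoc] at hprod ⊢
      rw [inv_mul_eq_iff_eq_mul, hprod]
    rw [h₂, hδ.eq] at h₁
    exact h₁.trans (cs.length_wordProd_le δ')
  subst hδδ'
  have hxω : x = cs.wordProd (α' ++ δ' ++ β') := by
    rw [hprod, hxd, wordProd_append, wordProd_append]
  have hlen : cs.length x = (α' ++ δ' ++ β').length := by rw [hxω, hred.eq]
  have hαnil : α' = [] := by
    rcases α' with _ | ⟨i, α'⟩
    · rfl
    · have h₁ := hx.1 _ (hα'J i (by simp))
      have h₂ : cs.simple i * x = cs.wordProd (α' ++ δ' ++ β') := by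
        rw [hxω]
        simp [wordProd_cons]
      have h₃ := cs.length_wordProd_le (α' ++ δ' ++ β')
      rw [h₂, hlen] at h₁
      simp at h₁ h₃
      omega
  have hβnil : β' = [] := by
    rcases List.eq_nil_or_concat β' with rfl | ⟨β₁, i, rfl⟩
    · rfl
    · have h₁ := hx.2 _ (hβ'K i (by simp))
      have h₂ : x * cs.simple i = cs.wordProd (α' ++ δ' ++ β₁) := by
        rw [hxω, concat_eq_append, ← append_assoc, wordProd_append]
        simp
      have h₃ := cs.length_wordProd_le (α' ++ δ' ++ β₁)
      rw [h₂, hlen] at h₁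
      simp at h₁ h₃
      omega
  rw [hxω, hαnil, hβnil]
  simp

theorem exists_forall_le_of_doubleCoset (H K : Subgroup W) (w : W) :
    ∃ a ∈ H, ∃ b ∈ K, ∀ a' ∈ H, ∀ b' ∈ K,
      cs.length (a * w * b) ≤ cs.length (a' * (a * w * b) * b') := by
  obtain ⟨⟨a, b⟩, hab⟩ :=
    exists_minimalFor_of_wellFoundedLT (fun _ : H × K => True)
      (fun p => cs.length ((p.1 : W) * w * p.2)) ⟨1, trivial⟩
  refine ⟨a, a.2, b, b.2, fun a' ha' b' hb' => ?_⟩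
  by_contra hlt
  have hle := hab.2 (j := (⟨a', ha'⟩ * a, b * ⟨b', hb'⟩)) trivial
  simp only [Subgroup.coe_mul, mul_assoc] at hle hlt
  exact hlt (hle (by omega))

theorem isDoubleCosetMin_of_forall_le {J K : Set W} (hJ : J ⊆ Set.range cs.simple)
    (hK : K ⊆ Set.range cs.simple) {d : W}
    (hd : ∀ a ∈ Subgroup.closure J, ∀ b ∈ Subgroup.closure K,
      cs.length d ≤ cs.length (a * d * b)) : cs.IsDoubleCosetMin J K d := by
  constructor
  · intro s hs
    obtain ⟨i, rfl⟩ := hJ hs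
    refine lt_of_le_of_ne ?_ (cs.length_simple_mul_ne d i).symm
    simpa using hd _ (Subgroup.subset_closure hs) 1 (one_mem _)
  · intro s hs
    obtain ⟨i, rfl⟩ := hK hs
    refine lt_of_le_of_ne ?_ (cs.length_mul_simple_ne d i).symm
    simpa using hd 1 (one_mem _) _ (Subgroup.subset_closure hs)

theorem IsDoubleCosetMin.eq {J K : Set W} (hJ : J ⊆ Set.range cs.simple)
    (hK : K ⊆ Set.range cs.simple) {x y u v : W} (hx : cs.IsDoubleCosetMin J K x)
    (hy : cs.IsDoubleCosetMin J K y) (hu : u ∈ Subgroup.closure J)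
    (hv : v ∈ Subgroup.closure K) (hxy : x = u * y * v) : x = y := by
  obtain ⟨a, ha, b, hb, hd⟩ :=
    cs.exists_forall_le_of_doubleCoset (Subgroup.closure J) (Subgroup.closure K) y
  have h₁ : y = a * y * b := cs.eq_of_isDoubleCosetMin_of_forall_le hJ hK hy (inv_mem ha)
    (inv_mem hb) (by simp [mul_assoc]) hd
  have h₂ : x = a * y * b := cs.eq_of_isDoubleCosetMin_of_forall_le hJ hK hx
    (mul_mem hu (inv_mem ha)) (mul_mem (inv_mem hb) hv) (by simp [hxy, mul_assoc]) hd
  rw [h₂, ← h₁]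

/-- The double cosets of two standard parabolic subgroups correspond to the elements without
left descents in `J` and right descents in `K`. -/
theorem card_orbits_prod_eq_card_isDoubleCosetMin {J K : Set W} (hJ : J ⊆ Set.range cs.simple)
    (hK : K ⊆ Set.range cs.simple) :
    Nat.card (Quotient (MulAction.orbitRel W
      ((W ⧸ Subgroup.closure J) × (W ⧸ Subgroup.closure K)))) =
      Nat.card {d : W // cs.IsDoubleCosetMin J K d} := by
  symm
  -- The orbit of (aW_J, bW_K) corresponds to the double coset of a⁻¹b, so (W_J, dW_K) represents
  -- that of d.
  refine Nat.card_eq_of_bijective (fun d => Quotient.mk _ (((1 : W) : W ⧸ Subgroup.closure J),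
    ((d : W) : W ⧸ Subgroup.closure K))) ⟨?_, ?_⟩
  · rintro ⟨x, hx⟩ ⟨y, hy⟩ hxy
    obtain ⟨g, hg⟩ := MulAction.orbitRel_apply.1 (Quotient.exact hxy)
    obtain ⟨h₁, h₂⟩ := Prod.ext_iff.1 hg
    simp only [Prod.smul_fst, Prod.smul_snd, MulAction.Quotient.smul_coe, smul_eq_mul,
      mul_one] at h₁ h₂
    have hg' : g ∈ Subgroup.closure J := by simpa using QuotientGroup.eq.1 h₁
    have h₃ := QuotientGroup.eq.1 h₂
    exact Subtype.ext (IsDoubleCosetMin.eq cs hJ hK hx hy hg' h₃ (by group))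
  · intro q
    induction q using Quotient.inductionOn with
    | h p =>
      obtain ⟨a, b⟩ := p
      induction a using QuotientGroup.induction_on with
      | H a =>
      induction b using QuotientGroup.induction_on with
      | H b =>
      obtain ⟨u, hu, v, hv, hd⟩ := cs.exists_forall_le_of_doubleCoset (Subgroup.closure J)
        (Subgroup.closure K) (a⁻¹ * b)
      refine ⟨⟨_, cs.isDoubleCosetMin_of_forall_le hJ hK hd⟩, Quotient.sound ?_⟩
      refine MulAction.orbitRel_apply.2 ⟨u * a⁻¹, Prod.ext ?_ ?_⟩
      · simpa [MulAction.Quotient.smul_coe] using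
          QuotientGroup.eq.2 (show (u * a⁻¹ * a)⁻¹ * 1 ∈ _ by simpa using hu)
      · simpa [MulAction.Quotient.smul_coe] using QuotientGroup.eq.2
          (show (u * a⁻¹ * b)⁻¹ * (u * (a⁻¹ * b) * v) ∈ _ by
            convert hv using 1
            group)

/-! ### The longest element -/

/-- Grow a reduced word of u letter by letter at its right end. The letter removed by exchange
cannot lie in the part υ already built, since υ followed by i is reduced; so it comes out of the
prefix ξ. -/
theorem exists_eq_mul_of_forall_isRightDescent {w : W} (hw : ∀ i, cs.IsRightDescent w i) (u : W) :
    ∃ x, w = x * u ∧ cs.length w = cs.length x + cs.length u := by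
  obtain ⟨υ, hυ, rfl⟩ := cs.exists_isReduced u
  induction υ using List.reverseRecOn with
  | nil => exact ⟨w, by simp, by simp⟩
  | append_singleton υ i ih =>
    have hυ' : cs.IsReduced υ := by simpa using hυ.take υ.length
    obtain ⟨x, hx, hlen⟩ := ih hυ'
    obtain ⟨ξ, hξ, rfl⟩ := cs.exists_isReduced x
    have hw' : w = cs.wordProd (ξ ++ υ) := by rw [hx, wordProd_append]
    obtain ⟨j, hj, hj'⟩ := cs.exists_eraseIdx_of_isRightDescent (hw' ▸ hw i)
    rw [← hw'] at hj'
    have hυi : cs.length (cs.wordProd (υ ++ [i])) = υ.length + 1 := by simpa using hυ.eq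
    rcases lt_or_ge j ξ.length with h | h
    · rw [eraseIdx_append_of_lt_length h] at hj'
      refine ⟨cs.wordProd (ξ.eraseIdx j), ?_, ?_⟩
      · rw [wordProd_append] at hj' ⊢
        rw [← mul_assoc, ← hj']
        simp
      · have hw'' : w = cs.wordProd (ξ.eraseIdx j) * cs.wordProd (υ ++ [i]) := by
          rw [wordProd_append] at hj' ⊢
          rw [← mul_assoc, ← hj']
          simp
        have h₁ := cs.length_mul_le (cs.wordProd (ξ.eraseIdx j)) (cs.wordProd (υ ++ [i]))
        rw [← hw''] at h₁
        have h₂ := cs.length_wordProd_le (ξ.eraseIdx j)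
        have h₃ := length_eraseIdx_add_one h
        rw [hξ.eq, hυ'.eq] at hlen
        omega
    · exfalso
      rw [eraseIdx_append_of_length_le h, wordProd_append, hx, mul_assoc] at hj'
      have h₁ := mul_left_cancel hj'
      have h₂ : cs.wordProd (υ ++ [i]) = cs.wordProd (υ.eraseIdx (j - ξ.length)) := by
        rw [← h₁]
        simp [wordProd_append]
      have h₃ := cs.length_wordProd_le (υ.eraseIdx (j - ξ.length))
      rw [← h₂, hυi] at h₃
      have := (eraseIdx_sublist υ (j - ξ.length)).length_le
      omega

/-- A finite Coxeter group has exactly one element all of whose simple reflections are left and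
right descents. -/
theorem existsUnique_forall_isDescent [Finite W] :
    ∃! w : W, (∀ i, cs.IsLeftDescent w i) ∧ ∀ i, cs.IsRightDescent w i := by
  obtain ⟨w, hw⟩ := Finite.exists_max cs.length
  refine ⟨w, ⟨fun i => lt_of_le_of_ne (hw _) (cs.length_simple_mul_ne w i),
    fun i => lt_of_le_of_ne (hw _) (cs.length_mul_simple_ne w i)⟩, ?_⟩
  rintro y ⟨-, hy⟩
  -- Here w has maximal length, so the additivity of lengths in y = xw forces x = 1.
  obtain ⟨x, hx, hlen⟩ := cs.exists_eq_mul_of_forall_isRightDescent hy w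
  have : cs.length x = 0 := by have := hw y; omega
  rw [hx, cs.length_eq_zero_iff.1 this, one_mul]

end CoxeterSystem

/-! ### Inner products of coset permutation characters -/

/-- Burnside's lemma for the product action, whose fixed points are pairs of fixed points. -/
theorem sum_cosetPermutationCharacter_mul {W : Type*} [Group W] [Fintype W] (J K : Set W) :
    ∑ w, cosetPermutationCharacter J w * cosetPermutationCharacter K w =
      Nat.card W * Nat.card (Quotient (MulAction.orbitRel W
        ((W ⧸ Subgroup.closure J) × (W ⧸ Subgroup.closure K)))) := by
  classical
  have := Fintype.ofFinite (W ⧸ Subgroup.closure J)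
  have := Fintype.ofFinite (W ⧸ Subgroup.closure K)
  have := Fintype.ofFinite (Quotient (MulAction.orbitRel W
        ((W ⧸ Subgroup.closure J) × (W ⧸ Subgroup.closure K))))
  have h := MulAction.sum_card_fixedBy_eq_card_orbits_mul_card_group W
    ((W ⧸ Subgroup.closure J) × (W ⧸ Subgroup.closure K))
  rw [Nat.card_eq_fintype_card, Nat.card_eq_fintype_card, mul_comm, ← Nat.cast_mul, ← h,
    Nat.cast_sum]
  refine Finset.sum_congr rfl fun w _ => ?_
  rw [cosetPermutationCharacter, cosetPermutationCharacter, ← Nat.cast_mul, ← Nat.card_prod,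
    ← Nat.card_eq_fintype_card]
  refine congrArg _ (Nat.card_congr ((Equiv.Set.prod _ _).symm.trans (Equiv.setCongr ?_)))
  ext ⟨a, b⟩
  simp [MulAction.mem_fixedBy]

/-- The stabilizer of gW_J contains gsg⁻¹, of sign -1; right translation by it negates the sum of ε
over the stabilizer. -/
theorem sum_cosetPermutationCharacter_mul_eq_zero {W : Type*} [Group W] [Fintype W] {J : Set W}
    (ε : W →* ℤ) {s : W} (hs : s ∈ J) (hε : ε s = -1) :
    ∑ w, cosetPermutationCharacter J w * ε w = 0 := by
  classical
  have := Fintype.ofFinite (W ⧸ Subgroup.closure J)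
  have h : ∀ w, cosetPermutationCharacter J w * ε w =
      ∑ q : W ⧸ Subgroup.closure J, if w • q = q then ε w else 0 := by
    intro w
    rw [Finset.sum_ite, Finset.sum_const_zero, add_zero, Finset.sum_const, nsmul_eq_mul,
      cosetPermutationCharacter, Nat.card_eq_fintype_card, Fintype.card_subtype]
    rfl
  simp only [h]
  rw [Finset.sum_comm]
  refine Finset.sum_eq_zero fun q _ => ?_
  induction q using QuotientGroup.induction_on with
  | H g =>
    have hr : ε (g * s * g⁻¹) = -1 := by
      have : ε g * ε g⁻¹ = 1 := by rw [← map_mul, mul_inv_cancel, map_one]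
      rw [map_mul, map_mul, hε, mul_neg_one, neg_mul, this]
    have hfix : (g * s * g⁻¹) • (g : W ⧸ Subgroup.closure J) = g := by
      rw [MulAction.Quotient.smul_coe, eq_comm, QuotientGroup.eq]
      simpa using Subgroup.subset_closure hs
    have key : ∑ w, (if w • (g : W ⧸ Subgroup.closure J) = g then ε w else 0) =
        -∑ w, (if w • (g : W ⧸ Subgroup.closure J) = g then ε w else 0) := by
      rw [← Finset.sum_neg_distrib, ← Equiv.sum_comp (Equiv.mulRight (g * s * g⁻¹))]
      refine Finset.sum_congr rfl fun w _ => ?_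
      rw [Equiv.coe_mulRight, mul_smul, hfix, map_mul, hr]
      split_ifs <;> simp
    omega

theorem cosetPermutationCharacter_empty_sum {W : Type*} [Group W] [Fintype W] (ε : W →* ℤ) :
    ∑ w, cosetPermutationCharacter (∅ : Set W) w * ε w = Nat.card W := by
  classical
  have hne : ∀ w ≠ 1, cosetPermutationCharacter (∅ : Set W) w * ε w = 0 := by
    intro w hw
    have : IsEmpty (MulAction.fixedBy (W ⧸ Subgroup.closure (∅ : Set W)) w) := by
      refine ⟨fun ⟨q, hq⟩ => ?_⟩
      induction q using QuotientGroup.induction_on with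
      | H g =>
        rw [MulAction.mem_fixedBy, MulAction.Quotient.smul_coe, eq_comm, QuotientGroup.eq,
          Subgroup.closure_empty, Subgroup.mem_bot] at hq
        refine hw ?_
        rw [inv_mul_eq_one, smul_eq_mul, eq_comm, mul_eq_right] at hq
        exact hq
    simp [cosetPermutationCharacter]
  rw [Finset.sum_eq_single 1 (fun w _ => hne w) (by simp), cosetPermutationCharacter, map_one,
    mul_one, MulAction.fixedBy_one_eq_univ, Nat.card_univ, Subgroup.closure_empty]
  exact congrArg _ (Nat.card_congr QuotientGroup.quotientBot.toEquiv)

/-! ### Solomon's theorem by a norm computation -/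

theorem mainTheorem3 {B W : Type*} [Group W] [Finite W] {M : CoxeterMatrix B}
    (cs : CoxeterSystem M W) :
    ∑ J ∈ cs.simpleReflections.powerset,
        (-1 : ℤ) ^ J.card • cosetPermutationCharacter (J : Set W) =
      ⇑cs.signCharacter := by
  classical
  have := Fintype.ofFinite W
  set S := cs.simpleReflections with hS
  have hmemS : ∀ s, s ∈ S ↔ s ∈ Set.range cs.simple := by
    simp [hS, CoxeterSystem.simpleReflections]
  have hsub : ∀ J ∈ S.powerset, (J : Set W) ⊆ Set.range cs.simple := fun J hJ s hs =>
    (hmemS s).1 (Finset.mem_powerset.1 hJ hs)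
  set χ : W → ℤ := ∑ J ∈ S.powerset, (-1 : ℤ) ^ J.card • cosetPermutationCharacter (J : Set W)
    with hχ
  set ε := cs.signCharacter with hε
  have hχ_apply : ∀ w, χ w =
      ∑ J ∈ S.powerset, (-1 : ℤ) ^ J.card * cosetPermutationCharacter (J : Set W) w := by
    simp [hχ, Finset.sum_apply]
  have hεε : ∑ w, ε w * ε w = Nat.card W := by
    have : ∀ w, ε w * ε w = 1 := fun w => by
      simp [hε, CoxeterSystem.signCharacter, ← mul_pow]
    simp [this]
  have hχε : ∑ w, χ w * ε w = Nat.card W := by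
    simp only [hχ_apply, Finset.sum_mul, mul_assoc]
    rw [Finset.sum_comm]
    simp only [← Finset.mul_sum]
    rw [Finset.sum_eq_single ∅]
    · simpa using cosetPermutationCharacter_empty_sum ε
    · intro J hJ hne
      obtain ⟨s, hs⟩ := Finset.nonempty_iff_ne_empty.2 hne
      obtain ⟨i, hi⟩ := hsub J hJ hs
      rw [sum_cosetPermutationCharacter_mul_eq_zero ε (s := s) hs, mul_zero]
      simp [hε, CoxeterSystem.signCharacter, ← hi]
    · simp
  have hχχ : ∑ w, χ w * χ w = Nat.card W := by
    have h₁ : ∑ w, χ w * χ w = ∑ J ∈ S.powerset, ∑ K ∈ S.powerset,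
        (-1 : ℤ) ^ J.card * (-1) ^ K.card *
          (Nat.card W * Nat.card {d : W // cs.IsDoubleCosetMin (J : Set W) K d}) := by
      simp only [hχ_apply, Finset.sum_mul_sum]
      rw [Finset.sum_comm]
      refine Finset.sum_congr rfl fun J hJ => ?_
      rw [Finset.sum_comm]
      refine Finset.sum_congr rfl fun K hK => ?_
      rw [← cs.card_orbits_prod_eq_card_isDoubleCosetMin (hsub J hJ) (hsub K hK),
        ← sum_cosetPermutationCharacter_mul, Finset.mul_sum]
      exact Finset.sum_congr rfl fun w _ => by ring
    -- The complements in S of the left and right descent sets of d.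
    let L : W → Finset W := fun d => S.filter fun s => cs.length d < cs.length (s * d)
    let R : W → Finset W := fun d => S.filter fun s => cs.length d < cs.length (d * s)
    have hcard : ∀ J ∈ S.powerset, ∀ K ∈ S.powerset,
        (Nat.card {d : W // cs.IsDoubleCosetMin (J : Set W) K d} : ℤ) =
          ∑ d, (if J ⊆ L d then 1 else 0) * (if K ⊆ R d then 1 else 0) := by
      intro J hJ K hK
      have hiff : ∀ d, cs.IsDoubleCosetMin (J : Set W) K d ↔ (J ⊆ L d ∧ K ⊆ R d) := by
        intro d
        rw [Finset.mem_powerset] at hJ hK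
        simp only [CoxeterSystem.IsDoubleCosetMin, L, R, Finset.subset_iff, Finset.mem_filter,
          Finset.mem_coe]
        exact ⟨fun h => ⟨fun s hs => ⟨hJ hs, h.1 s hs⟩, fun s hs => ⟨hK hs, h.2 s hs⟩⟩,
          fun h => ⟨fun s hs => (h.1 hs).2, fun s hs => (h.2 hs).2⟩⟩
      rw [Nat.card_eq_fintype_card, Fintype.card_subtype, Finset.card_filter, Nat.cast_sum]
      refine Finset.sum_congr rfl fun d _ => ?_
      rw [if_congr (hiff d) rfl rfl, ite_and]
      split_ifs <;> simp
    have hsum : ∀ A ⊆ S, ∑ J ∈ S.powerset, (-1 : ℤ) ^ J.card * (if J ⊆ A then 1 else 0) =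
        if A = ∅ then 1 else 0 := by
      intro A hA
      rw [← Finset.sum_powerset_neg_one_pow_card]
      simp only [mul_ite, mul_one, mul_zero]
      rw [← Finset.sum_filter]
      refine Finset.sum_congr ?_ fun _ _ => rfl
      ext J
      simp only [Finset.mem_filter, Finset.mem_powerset]
      exact ⟨fun h => h.2, fun h => ⟨h.trans hA, h⟩⟩
    have h₂ : ∑ w, χ w * χ w = Nat.card W *
        ∑ d, (if L d = ∅ then 1 else 0) * (if R d = ∅ then 1 else 0) := by
      rw [h₁]
      calc _ = ∑ J ∈ S.powerset, ∑ K ∈ S.powerset, ∑ d, (Nat.card W : ℤ) *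
              (((-1 : ℤ) ^ J.card * (if J ⊆ L d then 1 else 0)) *
                ((-1 : ℤ) ^ K.card * (if K ⊆ R d then 1 else 0))) := by
            refine Finset.sum_congr rfl fun J hJ => Finset.sum_congr rfl fun K hK => ?_
            rw [hcard J hJ K hK, Finset.mul_sum, Finset.mul_sum]
            exact Finset.sum_congr rfl fun d _ => by ring
        _ = ∑ d, (Nat.card W : ℤ) *
              ((∑ J ∈ S.powerset, (-1 : ℤ) ^ J.card * (if J ⊆ L d then 1 else 0)) *
                ∑ K ∈ S.powerset, (-1 : ℤ) ^ K.card * (if K ⊆ R d then 1 else 0)) := by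
            simp only [Finset.sum_mul_sum]
            simp only [Finset.mul_sum]
            conv_rhs => rw [Finset.sum_comm]
            exact Finset.sum_congr rfl fun J _ => Finset.sum_comm
        _ = _ := by
            rw [Finset.mul_sum]
            refine Finset.sum_congr rfl fun d _ => ?_
            rw [hsum _ (Finset.filter_subset _ _), hsum _ (Finset.filter_subset _ _)]
    have hL : ∀ d, L d = ∅ ↔ ∀ i, cs.IsLeftDescent d i := by
      intro d
      simp only [L, Finset.filter_eq_empty_iff, hmemS, Set.forall_mem_range, not_lt]
      exact forall_congr' fun i => ⟨fun h => lt_of_le_of_ne h (cs.length_simple_mul_ne d i),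
        le_of_lt⟩
    have hR : ∀ d, R d = ∅ ↔ ∀ i, cs.IsRightDescent d i := by
      intro d
      simp only [R, Finset.filter_eq_empty_iff, hmemS, Set.forall_mem_range, not_lt]
      exact forall_congr' fun i => ⟨fun h => lt_of_le_of_ne h (cs.length_mul_simple_ne d i),
        le_of_lt⟩
    obtain ⟨w₀, hw₀, huniq⟩ := cs.existsUnique_forall_isDescent
    rw [h₂, Finset.sum_eq_single w₀]
    · simp [(hL w₀).2 hw₀.1, (hR w₀).2 hw₀.2]
    · intro d _ hd
      by_contra hne
      refine hd (huniq d ⟨(hL d).1 ?_, (hR d).1 ?_⟩) <;>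
      · by_contra h
        simp [h] at hne
    · simp
  have hzero : ∑ w, (χ w - ε w) ^ 2 = 0 := by
    have : ∀ w, (χ w - ε w) ^ 2 = χ w * χ w - 2 * (χ w * ε w) + ε w * ε w := fun w => by ring
    simp only [this, Finset.sum_add_distrib, Finset.sum_sub_distrib, ← Finset.mul_sum, hχχ, hχε,
      hεε]
    ring
  funext w
  have := (Finset.sum_eq_zero_iff_of_nonneg fun w _ => sq_nonneg (χ w - ε w)).1 hzero w
    (Finset.mem_univ w)
  exact sub_eq_zero.1 (pow_eq_zero_iff two_ne_zero |>.1 this)
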